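/- Let $G$ be a group. Its automorphism tower is the system of groups $G_\alpha$ ($\alpha$ an ordinal) and homomorphisms $\pi_{\alpha,\beta}\colon G_\alpha\to G_\beta$ ($\alpha\le\beta$), with $\pi_{\alpha,\alpha}=\mathrm{id}$ and $\pi_{\beta,\gamma}\circ\pi_{\alpha,\beta}=\pi_{\alpha,\gamma}$, defined by transfinite recursion: $G_0=G$; $G_{\alpha+1}=\operatorname{Aut}(G_\alpha)$, where $\pi_{\alpha,\alpha+1}$ is the natural map sending $g$ to the inner automorphism $h\mapsto ghg^{-1}$; and $G_\mu=\varinjlim_{\alpha<\mu}G_\alpha$, with $\pi_{\alpha,\mu}$ the canonical maps, if $\mu$ is a limit ordinal. The tower terminates at stage $\alpha$ if the natural map $G_\alpha\to\operatorname{Aut}(G_\alpha)$ is an isomorphism. (1) Let $\lambda$ be an uncountable regular cardinal such that $|G_\alpha|<\lambda$ for every ordinal $\alpha<\lambda$. Then there is an ordinal $\gamma<\lambda$ such that $G_\gamma$ is centerless, i.e. has trivial center. (2) In particular, the tower terminates before the next inaccessible cardinal above $|G|$: if $\kappa$ is any (strongly) inaccessible cardinal with $|G|<\kappa$, then there is an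 ordinal $\alpha<\kappa$ such that the tower of $G$ terminates at stage $\alpha$. -/

import Mathlib

universe u

/-- A directed system of groups indexed by the ordinals: groups `stage α` and a commuting
system of homomorphisms `map h : stage α →* stage β` for `α ≤ β`. -/
structure GroupSystem where
  /-- the group `G_α` -/
  stage : Ordinal.{u} → Type u
  /-- the group structure of `G_α` -/
  group : ∀ α, Group (stage α)
  /-- the homomorphism `π_{α,β} : G_α → G_β` -/
  map : ∀ {α β : Ordinal.{u}}, α ≤ β → stage α →* stage β
  map_self : ∀ (α : Ordinal.{u}) (x : stage α), map (le_refl α) x = x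
  map_map : ∀ {α β γ : Ordinal.{u}} (h : α ≤ β) (h' : β ≤ γ) (x : stage α),
    map h' (map h x) = map (h.trans h') x

namespace GroupSystem

instance instGroupStage (S : GroupSystem.{u}) (α : Ordinal.{u}) : Group (S.stage α) := S.group α

instance instDirectedSystem (S : GroupSystem.{u}) (μ : Ordinal.{u}) :
    DirectedSystem (fun i : Set.Iio μ => S.stage i.1)
      (fun i j (h : i ≤ j) => S.map (α := i.1) (β := j.1) h) where
  map_self i x := S.map_self i.1 x
  map_map _ _ _ h h' x := S.map_map h h' x

/-- The direct limit `dirlim_{α < μ} G_α` of the groups below stage `μ`. -/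
abbrev LimitBelow (S : GroupSystem.{u}) (μ : Ordinal.{u}) : Type (u + 1) :=
  DirectLimit (fun i : Set.Iio μ => S.stage i.1)
    (fun i j (h : i ≤ j) => S.map (α := i.1) (β := j.1) h)

/-- The canonical map `dirlim_{α < μ} G_α → G_μ` induced by the homomorphisms `π_{α,μ}`. -/
def fromLimitBelow (S : GroupSystem.{u}) (μ : Ordinal.{u}) : S.LimitBelow μ → S.stage μ :=
  DirectLimit.lift _ (fun i x => S.map (le_of_lt i.2) x)
    (fun _ j h x => (S.map_map h (le_of_lt j.2) x).symm)

/-- The canonical map from the direct limit is a group homomorphism. -/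
theorem fromLimitBelow_one (S : GroupSystem.{u}) (μ : Ordinal.{u}) [Nonempty (Set.Iio μ)] :
    S.fromLimitBelow μ 1 = 1 :=
  map_one (S.map _)

theorem fromLimitBelow_mul (S : GroupSystem.{u}) (μ : Ordinal.{u}) [Nonempty (Set.Iio μ)]
    (x y : S.LimitBelow μ) :
    S.fromLimitBelow μ (x * y) = S.fromLimitBelow μ x * S.fromLimitBelow μ y := by
  induction x, y using DirectLimit.induction₂ with
  | _ i x y =>
    rw [DirectLimit.mul_def]
    exact map_mul (S.map _) x y

end GroupSystem

/-- An automorphism tower of `G`: `G_0 = G`, `G_{α+1} = Aut(G_α)` with `π_{α,α+1}` the natural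
map sending `g` to the inner automorphism `h ↦ g h g⁻¹`, and `G_μ = dirlim_{α < μ} G_α` for
limit ordinals `μ`. These requirements determine the tower up to a unique isomorphism. -/
structure AutomorphismTower (G : Type u) [Group G] extends GroupSystem.{u} where
  /-- the identification `G_0 = G` -/
  zeroEquiv : stage 0 ≃* G
  /-- the identification `G_{α+1} = Aut(G_α)` -/
  succEquiv : ∀ α : Ordinal.{u}, stage (α + 1) ≃* MulAut (stage α)
  succEquiv_map : ∀ (α : Ordinal.{u}) (g : stage α),
    succEquiv α (map (le_self_add : α ≤ α + 1) g) = MulAut.conj g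
  /-- the identification of `G_μ` with the direct limit -/
  bijective_fromLimitBelow : ∀ μ : Ordinal.{u}, Order.IsSuccLimit μ →
    Function.Bijective (toGroupSystem.fromLimitBelow μ)

namespace AutomorphismTower

open CategoryTheory CategoryTheory.Limits

/-- The step of the construction: `X ↦ Aut(X)` with the natural map `X → Aut(X)`, started at
(a copy in the next universe of) `G`. -/
def succStruct (G : Type u) [Group G] : SmallObject.SuccStruct GrpCat.{u + 1} where
  X₀ := GrpCat.of (ULift.{u + 1} G)
  succ X := GrpCat.of (MulAut X)
  toSucc _ := GrpCat.ofHom MulAut.conj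

theorem hasColimitsOfShape (J : Type (u + 1)) [LinearOrder J] [Nonempty J] :
    HasColimitsOfShape J GrpCat.{u + 1} :=
  ⟨fun F => ⟨⟨⟨_, GrpCat.FilteredColimits.colimitCoconeIsColimit.{u + 1, u + 1} F⟩⟩⟩⟩

instance hasIterationOfShape : HasIterationOfShape Ordinal.{u} GrpCat.{u + 1} where
  hasColimitsOfShape_of_isSuccLimit j hj :=
    haveI : Nonempty (Set.Iio j) := ⟨⟨0, hj.bot_lt⟩⟩
    hasColimitsOfShape _
  hasColimitsOfShape := hasColimitsOfShape _

/-- The transfinite iteration of `X ↦ Aut(X)` along the ordinals. -/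
noncomputable def iter (G : Type u) [Group G] : Ordinal.{u} ⥤ GrpCat.{u + 1} :=
  (succStruct G).iterationFunctor Ordinal.{u}

theorem iter_limit (G : Type u) [Group G] (μ : Ordinal.{u}) (hμ : Order.IsSuccLimit μ) :
    (∀ x : (iter G).obj μ, ∃ (α : Ordinal.{u}) (h : α < μ) (y : (iter G).obj α),
      (iter G).map (homOfLE h.le) y = x) ∧
    (∀ (α : Ordinal.{u}) (h : α < μ) (x y : (iter G).obj α),
      (iter G).map (homOfLE h.le) x = (iter G).map (homOfLE h.le) y →
      ∃ (β : Ordinal.{u}) (hαβ : α ≤ β), β < μ ∧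
        (iter G).map (homOfLE hαβ) x = (iter G).map (homOfLE hαβ) y) := by
  have : Nonempty (Set.Iio μ) := ⟨⟨0, hμ.bot_lt⟩⟩
  have : (iter G).IsWellOrderContinuous := by unfold iter; infer_instance
  have hc := (iter G).isColimitOfIsWellOrderContinuous μ hμ
  have hc' := isColimitOfPreserves (forget GrpCat.{u + 1}) hc
  constructor
  · intro x
    obtain ⟨j, y, hy⟩ := Types.jointly_surjective_of_isColimit hc' x
    exact ⟨j.1, j.2, y, hy⟩
  · intro α h x y hxy
    obtain ⟨k, f, hf⟩ := (Types.FilteredColimit.isColimit_eq_iff' hc'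
      (i := (⟨α, h⟩ : Set.Iio μ)) x y).1 hxy
    exact ⟨k.1, leOfHom f, k.2, hf⟩

theorem small_iter (G : Type u) [Group G] (α : Ordinal.{u}) : Small.{u} ((iter G).obj α) := by
  induction α using Ordinal.limitRecOn with
  | zero =>
    have e := ((succStruct G).iterationFunctorObjBotIso Ordinal.{u}).groupIsoToMulEquiv
    exact small_map (e.toEquiv.trans Equiv.ulift)
  | add_one α ih =>
    have e := ((succStruct G).iterationFunctorObjSuccIso α (not_isMax α)).groupIsoToMulEquiv
    have : Small.{u} (MulAut ((iter G).obj α)) :=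
      small_of_injective (f := fun e : MulAut ((iter G).obj α) => (e : _ → _))
        DFunLike.coe_injective
    exact small_map (β := MulAut ((iter G).obj α)) e.toEquiv
  | limit μ hμ ih =>
    have : ∀ i : Set.Iio μ, Small.{u} ((iter G).obj i.1) := fun i => ih i.1 i.2
    refine small_of_surjective (α := Σ i : Set.Iio μ, (iter G).obj i.1)
      (f := fun y => (iter G).map (homOfLE (le_of_lt y.1.2)) y.2) ?_
    intro x
    obtain ⟨α, h, y, hy⟩ := (iter_limit G μ hμ).1 x
    exact ⟨⟨⟨α, h⟩, y⟩, hy⟩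

/-- The stages of the transfinite iteration, transported back to the universe of `G`. -/
noncomputable def system (G : Type u) [Group G] : GroupSystem.{u} :=
  haveI := small_iter G
  { stage := fun α => Shrink.{u} ((iter G).obj α)
    group := fun _ => inferInstance
    map := fun {_ _} h => ((Shrink.mulEquiv.symm.toMonoidHom).comp
      ((iter G).map (homOfLE h)).hom).comp Shrink.mulEquiv.toMonoidHom
    map_self := by
      intro α x
      simp
    map_map := by
      intro α β γ h h' x
      have h'' : homOfLE (h.trans h') = homOfLE h ≫ homOfLE h' := rfl
      rw [h'', Functor.map_comp]
      simp }

/-- The identification of the stages with those of the iteration in the next universe. -/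
noncomputable def systemEquiv (G : Type u) [Group G] (α : Ordinal.{u}) :
    (system G).stage α ≃* (iter G).obj α :=
  haveI := small_iter G α
  Shrink.mulEquiv

theorem systemEquiv_map (G : Type u) [Group G] {α β : Ordinal.{u}} (h : α ≤ β)
    (x : (system G).stage α) :
    systemEquiv G β ((system G).map h x) = (iter G).map (homOfLE h) (systemEquiv G α x) := by
  have := small_iter G
  exact MulEquiv.apply_symm_apply Shrink.mulEquiv _

end AutomorphismTower

open CategoryTheory AutomorphismTower in
/-- The automorphism tower of `G`, constructed by transfinite recursion. -/
noncomputable def automorphismTower (G : Type u) [Group G] : AutomorphismTower G where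
  toGroupSystem := system G
  zeroEquiv := (systemEquiv G 0).trans
    (((succStruct G).iterationFunctorObjBotIso Ordinal.{u}).groupIsoToMulEquiv.trans
      MulEquiv.ulift)
  succEquiv α := (systemEquiv G (α + 1)).trans
    (((succStruct G).iterationFunctorObjSuccIso α (not_isMax α)).groupIsoToMulEquiv.trans
      (MulAut.congr (systemEquiv G α)).symm)
  succEquiv_map α g := by
    have h : (iter G).map (homOfLE (Order.le_succ α)) ≫
        ((succStruct G).iterationFunctorObjSuccIso α (not_isMax α)).hom =
        (succStruct G).toSucc ((iter G).obj α) := by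
      refine (congrArg (· ≫ _) ((succStruct G).iterationFunctor_map_succ α
        (not_isMax α))).trans ?_
      simp only [Category.assoc, Iso.inv_hom_id, Category.comp_id]
      rfl
    have h' : ((succStruct G).iterationFunctorObjSuccIso α (not_isMax α)).groupIsoToMulEquiv
        (systemEquiv G (α + 1) ((system G).map le_self_add g)) =
        (MulAut.conj (systemEquiv G α g) : MulAut ((iter G).obj α)) :=
      (congrArg _ (systemEquiv_map G le_self_add g)).trans
        (congrArg (fun f => f.hom (systemEquiv G α g)) h)
    change (MulAut.congr (systemEquiv G α)).symm _ = _
    refine (congrArg (MulAut.congr (systemEquiv G α)).symm h').trans ?_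
    ext x
    change (systemEquiv G α).symm ((MulAut.conj (systemEquiv G α g)) (systemEquiv G α x)) = _
    simp
  bijective_fromLimitBelow μ hμ := by
    obtain ⟨h₁, h₂⟩ := iter_limit G μ hμ
    constructor
    · intro x y
      induction x, y using DirectLimit.induction₂ with
      | _ i x y =>
        intro hxy
        have hxy' : (system G).map (le_of_lt i.2) x = (system G).map (le_of_lt i.2) y := hxy
        obtain ⟨β, h, hβ, e⟩ := h₂ i.1 i.2 (systemEquiv G _ x) (systemEquiv G _ y) (by
          rw [← systemEquiv_map, ← systemEquiv_map, hxy'])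
        rw [← systemEquiv_map, ← systemEquiv_map] at e
        exact Quotient.sound ⟨⟨β, hβ⟩, h, h, (systemEquiv G β).injective e⟩
    · intro x
      obtain ⟨α, h, y, hy⟩ := h₁ (systemEquiv G μ x)
      refine ⟨⟦⟨⟨α, h⟩, (systemEquiv G α).symm y⟩⟧, (systemEquiv G μ).injective ?_⟩
      refine (systemEquiv_map G h.le _).trans ?_
      rw [MulEquiv.apply_symm_apply, hy]

/-- The tower terminates at stage `α`: the natural map `G_α → Aut(G_α)`, sending `g` to
conjugation by `g`, is an isomorphism. -/
def AutomorphismTower.TerminatesAt {G : Type u} [Group G] (T : AutomorphismTower G)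
    (α : Ordinal.{u}) : Prop :=
  Function.Bijective (MulAut.conj : T.stage α →* MulAut (T.stage α))

/-! Both parts find a stage closed under a bounding function, using regularity. (1) As |G_α| < λ,
the elements of G_α that die before λ all die by some stage f(α) < λ. At a limit γ closed under f, a
central element of G_γ comes from some y ∈ G_α with α < γ. It dies at γ + 1, so y is already dead by
f(α) < γ, and the central element is 1 (`exists_center_eq_bot`). (2) Stages below κ have size < κ
(`mk_stage_lt`), so (1) gives a centerless G_γ. Above it all maps are injective and G_γ has trivial
centralizer (`trivialCentralizer_of_center_eq_bot`), so an element of a later stage is determined by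
how it conjugates G_γ. For β < κ there are fewer than κ maps G_γ → G_β, so those induced by
conjugation at some stage before κ are all induced by a stage f(β). Take δ closed under f, of
cofinality above |G_γ|. An automorphism of G_δ sends G_γ into some G_β with β < δ, so it agrees on
G_γ with conjugation by an element from a stage below δ, hence is inner. -/

section

open Cardinal Order

/-! ### Closure points below a regular cardinal. -/

theorem Cardinal.IsRegular.exists_ordinal_bound {κ : Cardinal.{u}} (hκ : κ.IsRegular)
    {ι : Type u} (hι : #ι < κ) (f : ι → Ordinal.{u}) (hf : ∀ i, f i < κ.ord) :
    ∃ b < κ.ord, ∀ i, f i ≤ b :=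
  ⟨⨆ i, f i, Ordinal.iSup_lt_of_lt_cof (by rwa [hκ.cof_ord]) hf, fun i => le_ciSup Ordinal.bddAbove_of_small i⟩

theorem Cardinal.IsRegular.exists_ordinal_bound_of_lt {κ : Cardinal.{u}} (hκ : κ.IsRegular)
    {o : Ordinal.{u}} (ho : o < κ.ord) (f : Ordinal.{u} → Ordinal.{u})
    (hf : ∀ i < o, f i < κ.ord) :
    ∃ b < κ.ord, ∀ i < o, f i ≤ b := by
  obtain ⟨b, hb, h⟩ := hκ.exists_ordinal_bound (ι := o.ToType)
    (by rw [Cardinal.mk_toType]; exact lt_ord.1 ho)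
    (fun i => f (Ordinal.ToType.mk.symm i).1) (fun i => hf _ (Ordinal.ToType.mk.symm i).2)
  exact ⟨b, hb, fun i hi => by simpa using h (Ordinal.ToType.mk ⟨i, hi⟩)⟩

namespace Ordinal

/-- The transfinite sequence whose `i`-th value is the least ordinal above `g` of all
previous values. -/
noncomputable def iterLsub (g : Ordinal.{u} → Ordinal.{u}) (i : Ordinal.{u}) : Ordinal.{u} :=
  ⨆ j : Set.Iio i, (g (iterLsub g j.1) + 1)
termination_by i
decreasing_by exact j.2

theorem apply_iterLsub_lt (g : Ordinal.{u} → Ordinal.{u}) {i j : Ordinal.{u}} (h : j < i) :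
    g (iterLsub g j) < iterLsub g i := by
  conv_rhs => rw [iterLsub]
  exact (lt_add_one _).trans_le (le_ciSup (f := fun j : Set.Iio i => g (iterLsub g j.1) + 1)
    bddAbove_of_small ⟨j, h⟩)

theorem exists_le_apply_of_lt_iterLsub {g : Ordinal.{u} → Ordinal.{u}} {i x : Ordinal.{u}}
    (h : x < iterLsub g i) : ∃ j < i, x ≤ g (iterLsub g j) := by
  rw [iterLsub] at h
  obtain ⟨j, hj⟩ := exists_lt_of_lt_ciSup' h
  exact ⟨j.1, j.2, lt_add_one_iff.1 hj⟩

theorem iterLsub_strictMono {g : Ordinal.{u} → Ordinal.{u}} (hg : ∀ x, x ≤ g x) :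
    StrictMono (iterLsub g) :=
  fun _ _ h => (hg _).trans_lt (apply_iterLsub_lt g h)

theorem iterLsub_lt_ord {κ : Cardinal.{u}} (hκ : κ.IsRegular) {g : Ordinal.{u} → Ordinal.{u}}
    (hg : ∀ x < κ.ord, g x < κ.ord) (i : Ordinal.{u}) (hi : i < κ.ord) :
    iterLsub g i < κ.ord := by
  induction i using WellFoundedLT.induction with
  | ind i ih =>
    obtain ⟨b, hb, h⟩ := hκ.exists_ordinal_bound_of_lt hi (fun j => g (iterLsub g j))
      (fun j hj => hg _ (ih j hj (hj.trans hi)))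
    by_contra! hcon
    have hs : IsSuccLimit κ.ord := isSuccLimit_ord hκ.aleph0_le
    obtain ⟨j, hj, hle⟩ := exists_le_apply_of_lt_iterLsub ((hs.succ_lt hb).trans_le hcon)
    exact absurd (hle.trans (h j hj)) (not_le.2 (lt_succ b))

/-- Below a regular cardinal `κ` there are closure points of cofinality at least any prescribed
regular `θ < κ`. -/
theorem exists_closed_of_isRegular {κ θ : Cardinal.{u}} (hκ : κ.IsRegular) (hθ : θ.IsRegular)
    (hθκ : θ < κ) (f : Ordinal.{u} → Ordinal.{u}) (hf : ∀ x < κ.ord, f x < κ.ord) :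
    ∃ δ < κ.ord, IsSuccLimit δ ∧ (∀ β < δ, f β < δ) ∧
      ∀ {ι : Type u} (b : ι → Ordinal.{u}), #ι < θ → (∀ i, b i < δ) →
        ∃ β < δ, ∀ i, b i ≤ β := by
  have hsκ : IsSuccLimit κ.ord := isSuccLimit_ord hκ.aleph0_le
  have hsθ : IsSuccLimit θ.ord := isSuccLimit_ord hθ.aleph0_le
  -- Replace `f` by an inflationary `g` bounding `f` on whole initial segments. Values at or above
  -- `κ.ord` only serve to make the iteration strictly monotone on all ordinals.
  have hbd : ∀ x : Ordinal.{u}, ∃ b, x ≤ b ∧ (∀ y ≤ x, f y ≤ b) ∧ (x < κ.ord → b < κ.ord) := by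
    intro x
    by_cases hx : x < κ.ord
    · obtain ⟨b, hb, h⟩ := hκ.exists_ordinal_bound_of_lt (hsκ.succ_lt hx) f
        (fun i hi => hf i (hi.trans (hsκ.succ_lt hx)))
      exact ⟨max x b, le_max_left _ _,
        fun y hy => (h y (lt_succ_of_le hy)).trans (le_max_right _ _), fun _ => max_lt hx hb⟩
    · refine ⟨max x (⨆ y : Set.Iic x, f y.1), le_max_left _ _, fun y hy => ?_,
        fun h => absurd h hx⟩
      exact (le_ciSup (f := fun y : Set.Iic x => f y.1) bddAbove_of_small ⟨y, hy⟩).trans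
        (le_max_right _ _)
  choose g hg₁ hg₂ hg₃ using hbd
  have hmono := iterLsub_strictMono hg₁
  have hlt : ∀ β < iterLsub g θ.ord, ∃ j < θ.ord, β < iterLsub g j := by
    intro β hβ
    obtain ⟨j, hj, h⟩ := exists_le_apply_of_lt_iterLsub hβ
    exact ⟨succ j, hsθ.succ_lt hj, h.trans_lt (apply_iterLsub_lt g (lt_succ j))⟩
  refine ⟨iterLsub g θ.ord, iterLsub_lt_ord hκ hg₃ _ (ord_lt_ord.2 hθκ), ?_, ?_, ?_⟩
  · rw [isSuccLimit_iff, isSuccPrelimit_iff_succ_lt]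
    refine ⟨fun h => ?_, fun β hβ => ?_⟩
    · exact (hmono hθ.ord_pos).not_ge (h.le.trans zero_le)
    · obtain ⟨j, hj, h⟩ := hlt β hβ
      exact (succ_le_of_lt h).trans_lt (hmono hj)
  · intro β hβ
    obtain ⟨j, hj, h⟩ := hlt β hβ
    exact (hg₂ _ _ h.le).trans_lt (apply_iterLsub_lt g hj)
  · intro ι b hι hb
    choose j hj h using fun i => hlt (b i) (hb i)
    -- Regularity of `θ` bounds the fewer than `θ` indices below `θ.ord`.
    obtain ⟨J, hJ, hJ'⟩ := hθ.exists_ordinal_bound hι j hj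
    exact ⟨iterLsub g J, hmono hJ, fun i => (h i).le.trans (hmono.monotone (hJ' i))⟩

end Ordinal

/-! ### Limit and successor stages; a centerless stage. -/

namespace AutomorphismTower

variable {G : Type u} [Group G] (T : AutomorphismTower G)

theorem exists_map_eq_of_isSuccLimit {μ : Ordinal.{u}} (hμ : IsSuccLimit μ) (x : T.stage μ) :
    ∃ (α : Ordinal.{u}) (h : α < μ) (y : T.stage α), T.map h.le y = x := by
  obtain ⟨z, hz⟩ := (T.bijective_fromLimitBelow μ hμ).2 x
  induction z using Quotient.inductionOn with
  | h z => exact ⟨z.1.1, z.1.2, z.2, hz⟩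

theorem exists_map_eq_one_of_isSuccLimit {μ : Ordinal.{u}} (hμ : IsSuccLimit μ) {α : Ordinal.{u}}
    (h : α < μ) {y : T.stage α} (hy : T.map h.le y = 1) :
    ∃ (β : Ordinal.{u}) (hβ : α ≤ β), β < μ ∧ T.map hβ y = 1 := by
  have key := (T.bijective_fromLimitBelow μ hμ).1
    (a₁ := (⟦⟨⟨α, h⟩, y⟩⟧ : T.LimitBelow μ)) (a₂ := (⟦⟨⟨α, h⟩, 1⟩⟧ : T.LimitBelow μ))
    (hy.trans (map_one (T.map h.le)).symm)
  obtain ⟨k, hk, hk', e⟩ := Quotient.exact key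
  exact ⟨k.1, hk, k.2, e.trans (map_one (T.map hk))⟩

/-- In Aut(G_α), conjugating the inner automorphism of g by φ gives the inner automorphism of φ(g).
-/
theorem mul_map_mul_inv {α : Ordinal.{u}} (h : T.stage (α + 1)) (g : T.stage α) :
    h * T.map (le_self_add : α ≤ α + 1) g * h⁻¹ =
      T.map (le_self_add : α ≤ α + 1) (T.succEquiv α h g) := by
  apply (T.succEquiv α).injective
  rw [map_mul, map_mul, T.succEquiv_map, T.succEquiv_map, map_inv]
  ext x
  simp [MulAut.conj_apply]

theorem map_succ_eq_one_iff {α : Ordinal.{u}} (z : T.stage α) :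
    T.map (le_self_add : α ≤ α + 1) z = 1 ↔ z ∈ Subgroup.center (T.stage α) := by
  rw [← (T.succEquiv α).injective.eq_iff, T.succEquiv_map, map_one, Subgroup.mem_center_iff]
  constructor
  · intro h g
    have := DFunLike.congr_fun h g
    rw [MulAut.conj_apply, MulAut.one_apply, mul_inv_eq_iff_eq_mul] at this
    exact this.symm
  · intro h
    ext g
    rw [MulAut.conj_apply, MulAut.one_apply, ← h g, mul_inv_cancel_right]

/-- If `κ` is regular and uncountable and the stages below `κ` have size less than `κ`, then one of
them is centerless. -/
theorem exists_center_eq_bot {κ : Cardinal.{u}} (hκ₀ : ℵ₀ < κ) (hκ : κ.IsRegular)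
    (hcard : ∀ α < κ.ord, #(T.stage α) < κ) :
    ∃ γ < κ.ord, Subgroup.center (T.stage γ) = ⊥ := by
  have hbd : ∀ α, α < κ.ord → ∃ b, b < κ.ord ∧ ∀ (y : T.stage α) (β : Ordinal.{u}) (h : α ≤ β),
      β < κ.ord → T.map h y = 1 → ∃ (β' : Ordinal.{u}) (h' : α ≤ β'), β' ≤ b ∧
        T.map h' y = 1 := by
    intro α hα
    have : ∀ y : T.stage α, ∃ r < κ.ord, ∀ (β : Ordinal.{u}) (h : α ≤ β), β < κ.ord →
        T.map h y = 1 → ∃ h' : α ≤ r, T.map h' y = 1 := by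
      intro y
      by_cases hy : ∃ (β : Ordinal.{u}) (h : α ≤ β), β < κ.ord ∧ T.map h y = 1
      · obtain ⟨β, h, hβ, e⟩ := hy
        exact ⟨β, hβ, fun _ _ _ _ => ⟨h, e⟩⟩
      · exact ⟨0, hκ.ord_pos, fun β h hβ e => absurd ⟨β, h, hβ, e⟩ hy⟩
    choose r hr hr' using this
    obtain ⟨b, hb, hrb⟩ := hκ.exists_ordinal_bound (hcard α hα) r hr
    refine ⟨b, hb, fun y β h hβ e => ?_⟩
    obtain ⟨h', e'⟩ := hr' y β h hβ e
    exact ⟨r y, h', hrb y, e'⟩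
  choose! f hf hf' using hbd
  -- Only a closed limit ordinal is needed, so cofinality parameter ℵ₀ suffices; this uses that `κ`
  -- is uncountable.
  obtain ⟨γ, hγκ, hγ, hclosed, -⟩ :=
    Ordinal.exists_closed_of_isRegular hκ isRegular_aleph0 hκ₀ f hf
  refine ⟨γ, hγκ, (Subgroup.eq_bot_iff_forall _).2 fun x hx => ?_⟩
  obtain ⟨α, hα, y, rfl⟩ := T.exists_map_eq_of_isSuccLimit hγ x
  rw [← T.map_succ_eq_one_iff, T.map_map] at hx
  obtain ⟨β, h, hβ, e⟩ := hf' α (hα.trans hγκ) y (γ + 1) _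
    ((isSuccLimit_ord hκ.aleph0_le).add_one_lt hγκ) hx
  rw [← T.map_map h (hβ.trans (hclosed α hα).le), e, map_one]

/-! ### The tower above a centerless stage. -/

section Centerless

variable {γ : Ordinal.{u}}

/-- In the tower above a stage `γ`, the image of `G_γ` has trivial centralizer in `G_α`. -/
def TrivialCentralizer (γ α : Ordinal.{u}) : Prop :=
  ∀ (h : γ ≤ α) (x : T.stage α), (∀ g : T.stage γ, x * T.map h g = T.map h g * x) → x = 1

variable {T}

theorem TrivialCentralizer.center_eq_bot {α : Ordinal.{u}} (hC : T.TrivialCentralizer γ α)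
    (h : γ ≤ α) : Subgroup.center (T.stage α) = ⊥ :=
  (Subgroup.eq_bot_iff_forall _).2 fun x hx =>
    hC h x fun _ => (Subgroup.mem_center_iff.1 hx _).symm

theorem injective_map_succ {α : Ordinal.{u}} (h : Subgroup.center (T.stage α) = ⊥) :
    Function.Injective (T.map (le_self_add : α ≤ α + 1)) := by
  rw [injective_iff_map_eq_one]
  intro z hz
  rwa [T.map_succ_eq_one_iff, h, Subgroup.mem_bot] at hz

/-- An automorphism of `G_α` fixing the image of `G_γ` is trivial if the image of `G_γ` has
trivial centralizer in `G_α`. -/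
theorem TrivialCentralizer.apply_map_eq {α : Ordinal.{u}} (hC : T.TrivialCentralizer γ α)
    (hγα : γ ≤ α) (φ : MulAut (T.stage α)) (hφ : ∀ g : T.stage γ, φ (T.map hγα g) = T.map hγα g)
    (β : Ordinal.{u}) (hγβ : γ ≤ β) (hβα : β ≤ α) (y : T.stage β) :
    φ (T.map hβα y) = T.map hβα y := by
  induction β using Ordinal.limitRecOn with
  | zero =>
    obtain rfl : γ = 0 := le_antisymm hγβ zero_le
    exact hφ y
  | add_one β ih =>
    obtain rfl | hlt := hγβ.eq_or_lt
    · exact hφ y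
    have hγβ' : γ ≤ β := lt_add_one_iff.1 hlt
    have hβα' : β ≤ α := le_self_add.trans hβα
    have key : ∀ g : T.stage β, T.map hβα y * T.map hβα' g * (T.map hβα y)⁻¹ =
        T.map hβα' (T.succEquiv β y g) := by
      intro g
      have := congrArg (T.map hβα) (T.mul_map_mul_inv y g)
      simpa [T.map_map] using this
    -- Conjugation by y sends G_γ into the image of G_β, which `φ` fixes. So y and φ(y) conjugate
    -- G_γ identically, and their quotient centralizes it.
    have h1 : (T.map hβα y)⁻¹ * φ (T.map hβα y) = 1 := by
      refine hC hγα _ fun g => ?_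
      have e1 := key (T.map hγβ' g)
      have e2 := congrArg φ e1
      rw [map_mul, map_mul, map_inv, ih hγβ' hβα', ih hγβ' hβα', ← e1, T.map_map,
        mul_inv_eq_iff_eq_mul] at e2
      rw [mul_assoc, e2]
      group
    exact (inv_mul_eq_one.1 h1).symm
  | limit μ hμ ih =>
    obtain ⟨δ, hδ, z, rfl⟩ := T.exists_map_eq_of_isSuccLimit hμ y
    rcases le_total γ δ with h | h
    · rw [T.map_map]
      exact ih δ hδ h _ z
    · obtain rfl | hlt := hγβ.eq_or_lt
      · exact hφ _
      · rw [← T.map_map h hlt.le, T.map_map]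
        exact ih γ hlt le_rfl _ _

/-- The two claims need a joint induction: trivial centralizers make successor maps injective, and
injectivity into a limit stage pulls commutation relations back to earlier stages. At a successor,
an element centralizing G_γ is an automorphism fixing G_γ pointwise, hence the identity. -/
theorem trivialCentralizer_of_center_eq_bot (hγ : Subgroup.center (T.stage γ) = ⊥)
    (α : Ordinal.{u}) (hγα : γ ≤ α) :
    T.TrivialCentralizer γ α ∧
      ∀ (β : Ordinal.{u}) (_ : γ ≤ β) (hβα : β ≤ α), Function.Injective (T.map hβα) := by
  have base : T.TrivialCentralizer γ γ := by
    intro h x hx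
    rw [← Subgroup.mem_bot, ← hγ, Subgroup.mem_center_iff]
    intro g
    simpa [T.map_self] using (hx g).symm
  have self : ∀ α : Ordinal.{u}, Function.Injective (T.map (le_refl α)) := fun α x y h => by
    simpa [T.map_self] using h
  induction α using Ordinal.limitRecOn with
  | zero =>
    obtain rfl : γ = 0 := le_antisymm hγα zero_le
    refine ⟨base, fun β hβ hβα => ?_⟩
    obtain rfl := le_antisymm hβ hβα
    exact self _
  | add_one α ih =>
    obtain rfl | hlt := hγα.eq_or_lt
    · refine ⟨base, fun β hβ hβα => ?_⟩
      obtain rfl := le_antisymm hβ hβα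
      exact self _
    have hγα' : γ ≤ α := lt_add_one_iff.1 hlt
    obtain ⟨hC, hinj⟩ := ih hγα'
    have hsucc := injective_map_succ (hC.center_eq_bot hγα')
    refine ⟨fun h x hx => ?_, fun β hβ hβα => ?_⟩
    · have hfix : ∀ g : T.stage γ, T.succEquiv α x (T.map hγα' g) = T.map hγα' g := by
        intro g
        apply hsucc
        rw [← T.mul_map_mul_inv, T.map_map, hx g, mul_inv_cancel_right]
      apply (T.succEquiv α).injective
      ext y
      have := hC.apply_map_eq hγα' _ hfix α hγα' le_rfl y
      simpa [T.map_self] using this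
    · obtain rfl | hlt' := hβα.eq_or_lt
      · exact self _
      · intro x y hxy
        have hβα' : β ≤ α := lt_add_one_iff.1 hlt'
        rw [← T.map_map hβα' le_self_add, ← T.map_map hβα' le_self_add] at hxy
        exact hinj β hβ hβα' (hsucc hxy)
  | limit μ hμ ih =>
    obtain rfl | hlt := hγα.eq_or_lt
    · refine ⟨base, fun β hβ hβα => ?_⟩
      obtain rfl := le_antisymm hβ hβα
      exact self _
    have hinj : ∀ (β : Ordinal.{u}) (_ : γ ≤ β) (hβα : β ≤ μ), Function.Injective (T.map hβα) := by
      intro β hβ hβμ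
      obtain rfl | hlt' := hβμ.eq_or_lt
      · exact self _
      · rw [injective_iff_map_eq_one]
        intro y hy
        obtain ⟨δ, hδ, hδμ, e⟩ := T.exists_map_eq_one_of_isSuccLimit hμ hlt' hy
        exact (injective_iff_map_eq_one _).1 ((ih δ hδμ (hβ.trans hδ)).2 β hβ hδ) y e
    refine ⟨fun h x hx => ?_, hinj⟩
    obtain ⟨δ, hδ, hγδ, y, rfl⟩ : ∃ (δ : Ordinal.{u}) (h : δ < μ) (_ : γ ≤ δ) (y : T.stage δ),
        T.map h.le y = x := by
      obtain ⟨δ, hδ, y, rfl⟩ := T.exists_map_eq_of_isSuccLimit hμ x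
      exact ⟨max γ δ, max_lt hlt hδ, le_max_left _ _, T.map (le_max_right _ _) y, T.map_map _ _ _⟩
    rw [(ih δ hδ hγδ).1 hγδ y, map_one]
    intro g
    apply hinj δ hγδ hδ.le
    rw [map_mul, map_mul, T.map_map]
    exact hx g

end Centerless

/-! ### Cardinalities and termination below an inaccessible. -/

theorem _root_.Cardinal.IsInaccessible.power_lt {κ a b : Cardinal.{u}} (hκ : κ.IsInaccessible)
    (ha : a < κ) (hb : b < κ) : a ^ b < κ := by
  calc a ^ b ≤ (2 ^ a) ^ b := power_le_power_right (cantor a).le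
    _ = 2 ^ (a * b) := (power_mul ..).symm
    _ < κ := hκ.isStrongPrelimit (mul_lt_of_lt hκ.isRegular.aleph0_le ha hb)

theorem mk_stage_lt {κ : Cardinal.{u}} (hκ : κ.IsInaccessible) (hG : #G < κ) (α : Ordinal.{u})
    (hα : α < κ.ord) : #(T.stage α) < κ := by
  induction α using Ordinal.limitRecOn with
  | zero => rwa [mk_congr T.zeroEquiv.toEquiv]
  | add_one α ih =>
    have ih := ih (lt_of_le_of_lt le_self_add hα)
    refine lt_of_le_of_lt ?_ (hκ.power_lt ih ih)
    rw [power_def]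
    exact mk_le_of_injective (f := fun x : T.stage (α + 1) => (T.succEquiv α x : _ → _))
      (DFunLike.coe_injective.comp (T.succEquiv α).injective)
  | limit μ hμ ih =>
    refine lt_of_le_of_lt (mk_le_of_surjective (α := Σ i : μ.ToType,
      T.stage (Ordinal.ToType.mk.symm i).1)
      (f := fun y => T.map (le_of_lt (Ordinal.ToType.mk.symm y.1).2) y.2) ?_) ?_
    · intro x
      obtain ⟨α, h, y, hy⟩ := T.exists_map_eq_of_isSuccLimit hμ x
      obtain ⟨i, hi⟩ := Ordinal.ToType.mk.symm.surjective (⟨α, h⟩ : Set.Iio μ)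
      obtain rfl : (Ordinal.ToType.mk.symm i).1 = α := congrArg Subtype.val hi
      exact ⟨⟨i, y⟩, hy⟩
    · rw [mk_sigma]
      refine sum_lt_of_isRegular hκ.isRegular ?_ fun i => ?_
      · rw [mk_toType]
        exact lt_ord.1 hα
      · have := (Ordinal.ToType.mk.symm i).2
        exact ih _ this (lt_trans this hα)

/-- If some stage below an inaccessible `κ` is centerless, the tower terminates below `κ`: at a
limit stage `δ` of large cofinality, an automorphism of `G_δ` conjugates the image of `G_γ` into
an earlier stage, so it agrees with an element of a stage below `δ`. -/
theorem exists_terminatesAt_of_center_eq_bot {κ : Cardinal.{u}} (hκ : κ.IsInaccessible)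
    (hcard : ∀ α < κ.ord, #(T.stage α) < κ) {γ : Ordinal.{u}} (hγκ : γ < κ.ord)
    (hγ : Subgroup.center (T.stage γ) = ⊥) :
    ∃ δ < κ.ord, T.TerminatesAt δ := by
  have hreg := hκ.isRegular
  -- Arbitrary functions `φ` are enough to count: |G_β|^|G_γ| < κ.
  let Q (β ξ : Ordinal.{u}) (φ : T.stage γ → T.stage β) : Prop :=
    ∃ (h₁ : γ ≤ ξ) (h₂ : β ≤ ξ) (x : T.stage ξ),
      ∀ g, x * T.map h₁ g * x⁻¹ = T.map h₂ (φ g)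
  have hbd : ∀ β, β < κ.ord → ∃ b, b < κ.ord ∧ γ ≤ b ∧ ∀ (φ : T.stage γ → T.stage β)
      (ξ : Ordinal.{u}), ξ < κ.ord → Q β ξ φ → ∃ ξ' ≤ b, Q β ξ' φ := by
    intro β hβ
    have : ∀ φ : T.stage γ → T.stage β, ∃ r < κ.ord, ∀ ξ < κ.ord, Q β ξ φ → Q β r φ := by
      intro φ
      by_cases hφ : ∃ ξ < κ.ord, Q β ξ φ
      · obtain ⟨ξ, hξ, h⟩ := hφ
        exact ⟨ξ, hξ, fun _ _ _ => h⟩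
      · exact ⟨0, hreg.ord_pos, fun ξ hξ h => absurd ⟨ξ, hξ, h⟩ hφ⟩
    choose r hr hr' using this
    obtain ⟨b, hb, hrb⟩ := hreg.exists_ordinal_bound
      (by simpa using hκ.power_lt (hcard β hβ) (hcard γ hγκ)) r hr
    exact ⟨max γ b, max_lt hγκ hb, le_max_left _ _, fun φ ξ hξ h =>
      ⟨r φ, (hrb φ).trans (le_max_right _ _), hr' φ ξ hξ h⟩⟩
  choose! f hf hγf hf' using hbd
  -- The successor lets families indexed by G_γ be bounded below `δ`; ℵ₀ guarantees that it is
  -- regular.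
  obtain ⟨δ, hδκ, hδ, hclosed, hcof⟩ := Ordinal.exists_closed_of_isRegular hreg
    (θ := succ (max ℵ₀ #(T.stage γ))) (isRegular_succ (le_max_left _ _))
    (hκ.isSuccLimit.succ_lt (max_lt hκ.aleph0_lt (hcard γ hγκ))) f hf
  -- The clause `γ ≤ b` in `hbd` was included to force this.
  have hγδ : γ < δ := (hγf 0 hreg.ord_pos).trans_lt (hclosed 0 hδ.bot_lt)
  have hC := fun α h => (trivialCentralizer_of_center_eq_bot (T := T) hγ α h).1
  refine ⟨δ, hδκ, ?_, fun Φ => ?_⟩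
  · rw [injective_iff_map_eq_one]
    intro z hz
    apply injective_map_succ ((hC δ hγδ.le).center_eq_bot hγδ.le)
    apply (T.succEquiv δ).injective
    rw [T.succEquiv_map, hz, map_one, map_one]
  · have hlim : ∀ g : T.stage γ, ∃ (β : Ordinal.{u}) (h : β < δ) (y : T.stage β),
        T.map h.le y = Φ (T.map hγδ.le g) := fun g => T.exists_map_eq_of_isSuccLimit hδ _
    choose b hb y hy using hlim
    obtain ⟨β, hβ, hbβ⟩ := hcof b (lt_succ_of_le (le_max_right _ _)) hb
    have hδ1 : δ + 1 < κ.ord := (isSuccLimit_ord hreg.aleph0_le).add_one_lt hδκ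
    have hu : ∀ g : T.stage γ, (T.succEquiv δ).symm Φ * T.map (hγδ.le.trans le_self_add) g *
        ((T.succEquiv δ).symm Φ)⁻¹ =
        T.map (hβ.le.trans le_self_add) (T.map (hbβ g) (y g)) := by
      intro g
      have := T.mul_map_mul_inv ((T.succEquiv δ).symm Φ) (T.map hγδ.le g)
      rw [MulEquiv.apply_symm_apply, ← hy g, T.map_map, T.map_map] at this
      rw [this, T.map_map]
    -- Stage `δ + 1` realizes this map by the element corresponding to `Φ`, so some stage `ξ ≤ f β <
    -- δ` realizes it too.
    obtain ⟨ξ, hξ, h₁, h₂, x, hx⟩ := hf' β (hβ.trans hδκ) (fun g => T.map (hbβ g) (y g)) _ hδ1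
      ⟨hγδ.le.trans le_self_add, hβ.le.trans le_self_add, _, hu⟩
    have hξδ : ξ ≤ δ := hξ.trans (hclosed β hβ).le
    have hξδ1 : ξ ≤ δ + 1 := hξδ.trans le_self_add
    have hxu : (T.map hξδ1 x)⁻¹ * (T.succEquiv δ).symm Φ = 1 := by
      refine hC (δ + 1) (hγδ.le.trans le_self_add) (hγδ.le.trans le_self_add) _ fun g => ?_
      have e := congrArg (T.map hξδ1) (hx g)
      rw [map_mul, map_mul, map_inv, T.map_map, T.map_map, ← hu g, eq_mul_inv_iff_mul_eq] at e
      rw [mul_assoc, ← e]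
      group
    refine ⟨T.map hξδ x, ?_⟩
    rw [← T.succEquiv_map, T.map_map, inv_mul_eq_one.1 hxu, MulEquiv.apply_symm_apply]

end AutomorphismTower

end

theorem mainTheorem3 {G : Type u} [Group G] :
    (∀ μ : Cardinal.{u}, Cardinal.aleph0 < μ → μ.IsRegular →
      (∀ α : Ordinal.{u}, α < μ.ord → Cardinal.mk ((automorphismTower G).stage α) < μ) →
      ∃ γ : Ordinal.{u}, γ < μ.ord ∧ Subgroup.center ((automorphismTower G).stage γ) = ⊥) ∧
    (∀ κ : Cardinal.{u}, κ.IsInaccessible → Cardinal.mk G < κ →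
      ∃ α : Ordinal.{u}, α < κ.ord ∧ (automorphismTower G).TerminatesAt α) := by
  refine ⟨fun μ hμ₀ hμ hcard => (automorphismTower G).exists_center_eq_bot hμ₀ hμ hcard,
    fun κ hκ hG => ?_⟩
  have hcard := (automorphismTower G).mk_stage_lt hκ hG
  obtain ⟨γ, hγκ, hγ⟩ :=
    (automorphismTower G).exists_center_eq_bot hκ.aleph0_lt hκ.isRegular hcard
  exact (automorphismTower G).exists_terminatesAt_of_center_eq_bot hκ hcard hγκ hγ
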